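/- All number fields are subfields of a fixed algebraic closure $\overline{\mathbb Q}$, and Artin representations (over ${\mathbb Q}$) are finite-dimensional complex representations of ${\rm Gal}(\overline{\mathbb Q}/{\mathbb Q})$ that factor through ${\rm Gal}(K/{\mathbb Q})$ for some finite Galois extension $K/{\mathbb Q}$, taken up to isomorphism. For an elliptic curve $E/{\mathbb Q}$ and a number field $K$ put $$ {\rm BSD}(E/K)=\frac{{\rm Reg}_{E/K}\cdot|{\rm Sha}_{E/K}|\cdot C_{E/K}}{|E(K)_{\rm tors}|^2},\qquad C_{E/K}=\prod_{v\nmid\infty}c_v(E/K)\left|\frac{\omega}{\omega_v^{\min}}\right|_v, $$ where ${\rm Reg}_{E/K}$ is the regulator of the N\'eron--Tate pairing over $K$, $c_v$ are the Tamagawa numbers, $\omega$ is a global minimal differential of $E/{\mathbb Q}$ and $\omega_v^{\min}$ a minimal differential of $E/K_v$. For a representation $\rho$ let ${\mathbb Q}(\rho)$ be the field generated by the values of its character, for ${\mathfrak g}\in{\rm Gal}({\mathbb Q}(\rho)/{\mathbb Q})$ let $\rho^{\mathfrak g}$ be the representation with character ${\mathfrak g}\circ{\rm Tr}\,\rho$,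 let ${\mathfrak f}_\rho$ be the Artin conductor of $\rho$ and ${\mathfrak f}_E$ the conductor of $E$. Write $E(K)_{\mathbb C}=E(K)\otimes_{\mathbb Z}{\mathbb C}$ and $\langle\cdot,\cdot\rangle$ for the inner product of characters. For an elliptic curve $E/{\mathbb Q}$ consider the following properties of a function that assigns to every (isomorphism class of an) Artin representation $\rho$ a number ${\rm BSD}(E,\rho)\in{\mathbb C}^\times$: * (C1) for every number field $K$, ${\rm Sha}_{E/K}$ is finite and ${\rm BSD}(E/K)={\rm BSD}(E,{\rm Ind}_{K/{\mathbb Q}}{\mathbf 1})$; * (C2) ${\rm BSD}(E,\rho\oplus\tau)={\rm BSD}(E,\rho)\,{\rm BSD}(E,\tau)$ for all $\rho,\tau$; * (C5) if $\rho$ factors through ${\rm Gal}(K/{\mathbb Q})$ with $K/{\mathbb Q}$ finite Galois and $\langle\rho,E(K)_{\mathbb C}\rangle=0$, then ${\rm BSD}(E,\rho)\in{\mathbb Q}(\rho)^\times$ and ${\rm BSD}(E,\rho^{\mathfrak g})={\rm BSD}(E,\rho)^{\mathfrak g}$ for all ${\mathfrak g}\in{\rm Gal}({\mathbb Q}(\rho)/{\mathbb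 Q})$; * (C6) if $\rho$ factors through ${\rm Gal}(K/{\mathbb Q})$ with $K/{\mathbb Q}$ finite Galois, $\langle\rho,E(K)_{\mathbb C}\rangle=0$, $\rho$ is a non-trivial one-dimensional Artin representation (that is, a non-trivial primitive Dirichlet character) of order $n$, and either ${\mathfrak f}_E$ and ${\mathfrak f}_\rho$ are coprime or $E$ is semistable and has no non-trivial isogenies over ${\mathbb Q}$, then ${\rm BSD}(E,\rho)\in{\mathbb Z}[\zeta_n]$. **Theorem.** Let $G$ be a finite group and $\rho$ an irreducible complex representation of $G$. Suppose that, as virtual representations of $G$, $$ \Big(\bigoplus_{{\mathfrak g}\in{\rm Gal}({\mathbb Q}(\rho)/{\mathbb Q})}\rho^{\mathfrak g}\Big)^{\oplus m}=\Big(\bigoplus_i{\rm Ind}_{H_i}^G{\mathbf 1}\Big)\ominus\Big(\bigoplus_j{\rm Ind}_{H_j'}^G{\mathbf 1}\Big) $$ for some $m\in{\mathbb Z}$ and finite families of subgroups $H_i,H_j'\le G$. Let $E/{\mathbb Q}$ be an elliptic curve and $F/{\mathbb Q}$ a Galois extension with Galois group $G$. 1. If there are invariants ${\rm BSD}(E,\cdot)$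 satisfying (C1), (C2) and (C5), then either $\langle\rho,E(F)_{\mathbb C}\rangle>0$ or $$ \frac{\prod_i{\rm BSD}(E/F^{H_i})}{\prod_j{\rm BSD}(E/F^{H_j'})}=N_{{\mathbb Q}(\rho)/{\mathbb Q}}(x)^m\qquad\text{for some }x\in{\mathbb Q}(\rho). $$ 2. Suppose there are invariants ${\rm BSD}(E,\cdot)$ satisfying (C1), (C2), (C5) and (C6), $\rho$ is non-trivial and $G$ is abelian of exponent $d$. If ${\mathfrak f}_E$ and ${\mathfrak f}_\rho$ are coprime (with $\rho$ regarded as an Artin representation through $G={\rm Gal}(F/{\mathbb Q})$), or if $E$ is semistable and has no non-trivial isogenies over ${\mathbb Q}$, then in the second alternative of part 1 one can take $x\in{\mathbb Q}(\rho)\cap{\mathbb Z}[\zeta_d]$. -/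

import Mathlib

open scoped ComplexOrder

-- For subfields of a fixed field, prefer the structural `ℚ`-algebra instances.
attribute [instance 2000] AlgebraicClosure.instAlgebra IntermediateField.algebra'

noncomputable section

namespace BSDTwist

open NumberField IsDedekindDomain Filter TensorProduct
open scoped Classical

/-! ### Local invariants at a finite place -/

section Local

variable (R : Type*) [CommRing R] [IsDomain R] [IsDiscreteValuationRing R]
  {L : Type*} [Field L] [Algebra R L] [IsFractionRing R L]

/-- The points of a minimal Weierstrass equation `W` over `L = Frac R` whose reduction is a
nonsingular point of the reduced curve. A point with non-integral `x`-coordinate reduces to the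
point at infinity. -/
def nonsingularReduction (W : WeierstrassCurve L) [W.IsMinimal R] : Set W.toAffine.Point :=
  {P | ∀ (x y : L) (h : W.toAffine.Nonsingular x y), P = .some x y h →
    (∀ a : R, algebraMap R L a ≠ x) ∨
    ∃ a b : R, algebraMap R L a = x ∧ algebraMap R L b = y ∧
      (W.reduction R).toAffine.Nonsingular (IsLocalRing.residue R a) (IsLocalRing.residue R b)}

/-- The local Tamagawa number `[E(L) : E₀(L)]`. The set of points with nonsingular reduction is
already a subgroup, so that taking its closure does not change it. -/
def tamagawa (W : WeierstrassCurve L) : ℕ :=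
  (AddSubgroup.closure (nonsingularReduction R (W.minimal R))).index

/-- The scaling `u` of a change of variables from `W` to a minimal equation over `R`. The
invariant differentials satisfy `ω_min = u ω`. -/
def minimalScaling (W : WeierstrassCurve L) : L :=
  ((W.exists_isMinimal R).choose.u : L)

end Local

/-! ### Elliptic curves over number fields -/

section Global

variable {K : Type*} [Field K]

/-- The naive logarithmic height of the `x`-coordinate, relative to `K` (not divided by the
degree of `K`). -/
def naiveHeight [NumberField K] (W : WeierstrassCurve K) : W.toAffine.Point → ℝ
  | .zero => 0
  | .some x _ _ => Height.logHeight₁ x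

/-- The quadratic form `P ↦ ⟨P, P⟩` of the Néron--Tate pairing over `K`, that is
`lim 4⁻ⁿ h(x(2ⁿP))`. -/
def heightForm [NumberField K] (W : WeierstrassCurve K) (P : W.toAffine.Point) : ℝ :=
  limUnder atTop fun n : ℕ => naiveHeight W ((2 ^ n : ℕ) • P) / 4 ^ n

/-- The Néron--Tate height pairing over `K`. -/
def heightPairing [NumberField K] (W : WeierstrassCurve K) (P Q : W.toAffine.Point) : ℝ :=
  (heightForm W (P + Q) - heightForm W P - heightForm W Q) / 2

/-- `P₁, …, Pₙ` is a basis of the Mordell--Weil group modulo torsion. -/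
def IsMordellWeilBasis (W : WeierstrassCurve K) {n : ℕ} (P : Fin n → W.toAffine.Point) : Prop :=
  LinearIndependent ℤ P ∧
    AddSubgroup.closure (Set.range P) ⊔ AddCommGroup.torsion W.toAffine.Point = ⊤

/-- The regulator: the absolute value of the determinant of the height pairing on a basis of the
Mordell--Weil group modulo torsion. -/
def regulator [NumberField K] (W : WeierstrassCurve K) : ℝ :=
  if h : ∃ (n : ℕ) (P : Fin n → W.toAffine.Point), IsMordellWeilBasis W P then
    |(Matrix.of fun i j => heightPairing W (h.choose_spec.choose i)
      (h.choose_spec.choose j)).det|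
  else 0

/-- The group of points over an algebraic closure. -/
abbrev GeomPoint (W : WeierstrassCurve K) (L : Type*) [Field L] [Algebra K L] : Type _ :=
  (W.baseChange (AlgebraicClosure L)).toAffine.Point

/-- The Galois action on points. -/
abbrev galPoint (W : WeierstrassCurve K) {S L : Type*} [Field S] [Field L] [Algebra K S]
    [Algebra S L] [Algebra K L] [IsScalarTower K S L] (σ : L ≃ₐ[S] L) :
    (W.baseChange L).toAffine.Point →+ (W.baseChange L).toAffine.Point :=
  WeierstrassCurve.Affine.Point.map (W' := W) (σ : L →ₐ[S] L)

/-- A cochain on `G_K` with values in `E(K̄)` becomes a coboundary over the extension `L` of `K`: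
for every embedding of algebraic closures over `K`, its restriction to `G_L` is
`σ ↦ σQ - Q` for some point `Q` over the algebraic closure of `L`. -/
def IsTrivialOver (W : WeierstrassCurve K) (L : Type*) [Field L] [Algebra K L]
    (f : (AlgebraicClosure K ≃ₐ[K] AlgebraicClosure K) → GeomPoint W K) : Prop :=
  ∀ j : AlgebraicClosure K →ₐ[K] AlgebraicClosure L, ∃ Q : GeomPoint W L,
    ∀ (σ : AlgebraicClosure L ≃ₐ[L] AlgebraicClosure L)
      (τ : AlgebraicClosure K ≃ₐ[K] AlgebraicClosure K), (∀ x, j (τ x) = σ (j x)) →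
      WeierstrassCurve.Affine.Point.map (W' := W) j (f τ) = galPoint W σ Q - Q

/-- Continuous `1`-cocycles of `G_K` in `E(K̄)` that are locally trivial at all places. -/
def shaCocycles [NumberField K] (W : WeierstrassCurve K) :
    AddSubgroup ((AlgebraicClosure K ≃ₐ[K] AlgebraicClosure K) → GeomPoint W K) where
  carrier := {f | IsLocallyConstant f ∧ (∀ σ τ, f (σ * τ) = f σ + galPoint W σ (f τ)) ∧
    (∀ v : HeightOneSpectrum (𝓞 K), IsTrivialOver W (v.adicCompletion K) f) ∧
    ∀ v : InfinitePlace K, IsTrivialOver W v.Completion f}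
  zero_mem' := by
    have h0 : ∀ (L : Type _) [Field L] [Algebra K L], IsTrivialOver W L
        (0 : (AlgebraicClosure K ≃ₐ[K] AlgebraicClosure K) → GeomPoint W K) :=
      fun L _ _ j => ⟨0, fun σ τ _ => by simp⟩
    exact ⟨IsLocallyConstant.const 0, fun σ τ => by simp, fun v => h0 _, fun v => h0 _⟩
  add_mem' := by
    rintro f g ⟨hf, hf1, hf2, hf3⟩ ⟨hg, hg1, hg2, hg3⟩
    have h : ∀ (L : Type _) [Field L] [Algebra K L], IsTrivialOver W L f →
        IsTrivialOver W L g → IsTrivialOver W L (f + g) := by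
      intro L _ _ h1 h2 j
      obtain ⟨Q, hQ⟩ := h1 j
      obtain ⟨Q', hQ'⟩ := h2 j
      refine ⟨Q + Q', fun σ τ hστ => ?_⟩
      rw [Pi.add_apply, map_add, map_add, hQ σ τ hστ, hQ' σ τ hστ]
      abel
    refine ⟨hf.add hg, fun σ τ => ?_, fun v => h _ (hf2 v) (hg2 v), fun v => h _ (hf3 v) (hg3 v)⟩
    simp only [Pi.add_apply, hf1, hg1, map_add]
    abel
  neg_mem' := by
    rintro f ⟨hf, hf1, hf2, hf3⟩
    have h : ∀ (L : Type _) [Field L] [Algebra K L], IsTrivialOver W L f →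
        IsTrivialOver W L (-f) := by
      intro L _ _ h1 j
      obtain ⟨Q, hQ⟩ := h1 j
      refine ⟨-Q, fun σ τ hστ => ?_⟩
      rw [Pi.neg_apply, map_neg, map_neg, hQ σ τ hστ]
      abel
    refine ⟨hf.neg, fun σ τ => ?_, fun v => h _ (hf2 v), fun v => h _ (hf3 v)⟩
    simp only [Pi.neg_apply, hf1, map_neg]
    abel

/-- The `1`-coboundaries `σ ↦ σP - P`. -/
def coboundaries (W : WeierstrassCurve K) :
    AddSubgroup ((AlgebraicClosure K ≃ₐ[K] AlgebraicClosure K) → GeomPoint W K) where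
  carrier := {f | ∃ P : GeomPoint W K, ∀ σ, f σ = galPoint W σ P - P}
  zero_mem' := ⟨0, fun σ => by simp⟩
  add_mem' := by
    rintro f g ⟨P, hP⟩ ⟨Q, hQ⟩
    refine ⟨P + Q, fun σ => ?_⟩
    rw [Pi.add_apply, map_add, hP, hQ]
    abel
  neg_mem' := by
    rintro f ⟨P, hP⟩
    refine ⟨-P, fun σ => ?_⟩
    rw [Pi.neg_apply, map_neg, hP]
    abel

/-- The Tate--Shafarevich group `ker (H¹(K, E) → ∏ᵥ H¹(Kᵥ, E))`. -/
abbrev Sha [NumberField K] (W : WeierstrassCurve K) : Type _ :=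
  shaCocycles W ⧸ (coboundaries W).addSubgroupOf (shaCocycles W)

end Global

/-! ### The quotient `BSD(E/K)` for `E/ℚ` -/

section BSD

variable (E : WeierstrassCurve ℚ)

/-- A Weierstrass equation over `ℚ` that is minimal at every prime. -/
def IsGloballyMinimal : Prop :=
  ∀ (p : ℕ) [Fact p.Prime], (E.baseChange ℚ_[p]).IsMinimal ℤ_[p]

/-- A globally minimal equation of `E`. -/
def globalMinimal : WeierstrassCurve ℚ :=
  if h : ∃ C : WeierstrassCurve.VariableChange ℚ, IsGloballyMinimal (C • E) then h.choose • E else E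

variable (K : Type*) [Field K] [NumberField K]

/-- The factor `c_v(E/K) |ω / ω_v^min|_v`, where `ω` is the invariant differential of a globally
minimal equation of `E` over `ℚ` and `|·|_v` is the normalised absolute value. -/
def localFactor (v : HeightOneSpectrum (𝓞 K)) : ℝ :=
  tamagawa (v.adicCompletionIntegers K) ((E.baseChange K).baseChange (v.adicCompletion K)) *
  ‖minimalScaling (v.adicCompletionIntegers K)
      (((globalMinimal E).baseChange K).baseChange (v.adicCompletion K))‖⁻¹

/-- `BSD(E/K) = Reg(E/K) |Ш(E/K)| C(E/K) / |E(K)_tors|²`. -/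
def BSDQuotient : ℝ :=
  regulator (E.baseChange K) * Nat.card (Sha (E.baseChange K)) *
    (∏ᶠ v : HeightOneSpectrum (𝓞 K), localFactor E K v) /
    (Nat.card (AddCommGroup.torsion (E.baseChange K).toAffine.Point) : ℝ) ^ 2

end BSD

/-! ### Characters -/

section Characters

variable {G : Type*} [Group G] {V : Type*} [AddCommGroup V] [Module ℂ V]

/-- The field `ℚ(ρ)` generated by the values of the character of `ρ`. -/
abbrev charField (ρ : Representation ℂ G V) : IntermediateField ℚ ℂ :=
  IntermediateField.adjoin ℚ (Set.range ρ.character)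

/-- The character value `Tr ρ(g)` as an element of `ℚ(ρ)`. -/
def charValue (ρ : Representation ℂ G V) (g : G) : charField ρ :=
  ⟨ρ.character g, IntermediateField.subset_adjoin _ _ ⟨g, rfl⟩⟩

/-- The usual inner product `⟨χ, ψ⟩ = |G|⁻¹ ∑ χ(g) ψ(g⁻¹)` of characters. -/
def charInner [Fintype G] (χ ψ : G → ℂ) : ℂ :=
  (Fintype.card G : ℂ)⁻¹ * ∑ g, χ g * ψ g⁻¹

/-- The representation `Ind_H^G 1`, realised as the permutation representation on `G / H`. -/
abbrev indOne (H : Subgroup G) : Representation ℂ G (MonoidAlgebra ℂ (G ⧸ H)) :=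
  Representation.ofMulAction ℂ G (G ⧸ H)

/-- The ring `ℤ[ζ_d]` inside `ℂ`. -/
def cyclotomicInt (d : ℕ) : Subalgebra ℤ ℂ :=
  Algebra.adjoin ℤ {Complex.exp (2 * Real.pi * Complex.I / d)}

end Characters

/-! ### Artin representations over `ℚ` -/

/-- The fixed algebraic closure of `ℚ`. -/
abbrev Qbar : Type := AlgebraicClosure ℚ

/-- The absolute Galois group of `ℚ`. -/
abbrev GQ : Type := Qbar ≃ₐ[ℚ] Qbar

/-- An Artin representation over `ℚ`: a finite-dimensional complex representation of `G_ℚ` that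
factors through `Gal(K/ℚ)` for a finite Galois extension `K/ℚ`. -/
structure ArtinRep where
  /-- The underlying complex vector space. -/
  V : Type
  [addCommGroup : AddCommGroup V]
  [module : Module ℂ V]
  [finiteDimensional : FiniteDimensional ℂ V]
  /-- The action of the absolute Galois group. -/
  ρ : Representation ℂ GQ V
  factors : ∃ K : IntermediateField ℚ Qbar, FiniteDimensional ℚ K ∧ IsGalois ℚ K ∧
    ∀ σ ∈ K.fixingSubgroup, ρ σ = 1

attribute [instance] ArtinRep.addCommGroup ArtinRep.module ArtinRep.finiteDimensional

namespace ArtinRep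

/-- The Artin representation defined by a representation of `Gal(K/ℚ)`. -/
def inflate (K : IntermediateField ℚ Qbar) [FiniteDimensional ℚ K] [IsGalois ℚ K] {V : Type}
    [AddCommGroup V] [Module ℂ V] [FiniteDimensional ℂ V] (ρ : Representation ℂ (K ≃ₐ[ℚ] K) V) :
    ArtinRep where
  V := V
  ρ := ρ.comp (AlgEquiv.restrictNormalHom K)
  factors := by
    refine ⟨K, inferInstance, inferInstance, fun σ hσ => ?_⟩
    rw [← IntermediateField.restrictNormalHom_ker] at hσ
    rw [MonoidHom.comp_apply, MonoidHom.mem_ker.mp hσ, map_one]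

/-- The direct sum of two Artin representations. -/
def sum (ρ τ : ArtinRep) : ArtinRep where
  V := ρ.V × τ.V
  ρ := ρ.ρ.prod τ.ρ
  factors := by
    obtain ⟨K, hK, hK', h⟩ := ρ.factors
    obtain ⟨L, hL, hL', h'⟩ := τ.factors
    refine ⟨K ⊔ L, inferInstance, inferInstance, fun σ hσ => ?_⟩
    have h1 := h σ (IntermediateField.fixingSubgroup_antitone le_sup_left hσ)
    have h2 := h' σ (IntermediateField.fixingSubgroup_antitone le_sup_right hσ)
    ext x <;> simp [h1, h2]

instance finite_quotient (K : IntermediateField ℚ Qbar) [FiniteDimensional ℚ K] :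
    Finite (GQ ⧸ K.fixingSubgroup) :=
  Subgroup.quotient_finite_of_isOpen _ K.fixingSubgroup_isOpen

/-- The representation `Ind_{K/ℚ} 1` for a number field `K`. -/
def ind (K : IntermediateField ℚ Qbar) [FiniteDimensional ℚ K] : ArtinRep where
  V := MonoidAlgebra ℂ (GQ ⧸ K.fixingSubgroup)
  finiteDimensional := Module.Finite.equiv (MonoidAlgebra.coeffLinearEquiv ℂ).symm
  ρ := indOne K.fixingSubgroup
  factors := by
    refine ⟨IntermediateField.normalClosure ℚ K Qbar, inferInstance, ⟨⟩, fun σ hσ => ?_⟩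
    have h : ∀ q : GQ ⧸ K.fixingSubgroup, σ • q = q := by
      intro q
      induction q using QuotientGroup.induction_on with
      | H g =>
        rw [MulAction.Quotient.smul_coe, eq_comm, QuotientGroup.eq, smul_eq_mul,
          IntermediateField.mem_fixingSubgroup_iff]
        intro x hx
        have hgx : g x ∈ IntermediateField.normalClosure ℚ K Qbar := by
          have := ((g : Qbar →ₐ[ℚ] Qbar).comp K.val).fieldRange_le_normalClosure
          exact this ⟨⟨x, hx⟩, rfl⟩
        have := (IntermediateField.mem_fixingSubgroup_iff _ _).mp hσ _ hgx
        simp only [AlgEquiv.mul_apply, this]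
        exact g.symm_apply_apply x
    ext q
    simp [h]

end ArtinRep

/-- The action of an automorphism of `L` on `E(L)`, as a `ℤ`-linear map. -/
def galLin (E : WeierstrassCurve ℚ) {L : Type*} [Field L] [Algebra ℚ L] (σ : L ≃ₐ[ℚ] L) :
    (E.baseChange L).toAffine.Point →ₗ[ℤ] (E.baseChange L).toAffine.Point where
  toFun := galPoint E σ
  map_add' := map_add (galPoint E σ)
  map_smul' n P := map_zsmul (galPoint E σ) n P

theorem galLin_one (E : WeierstrassCurve ℚ) {L : Type*} [Field L] [Algebra ℚ L] :
    galLin E (1 : L ≃ₐ[ℚ] L) = LinearMap.id := by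
  refine LinearMap.ext fun P => ?_
  cases P <;> rfl

theorem galLin_mul (E : WeierstrassCurve ℚ) {L : Type*} [Field L] [Algebra ℚ L]
    (σ τ : L ≃ₐ[ℚ] L) : galLin E (σ * τ) = galLin E σ ∘ₗ galLin E τ := by
  refine LinearMap.ext fun P => ?_
  cases P <;> rfl

/-- The representation of `Gal(L/ℚ)` on `E(L) ⊗ ℂ`. -/
def mordellWeil (E : WeierstrassCurve ℚ) (L : Type*) [Field L] [Algebra ℚ L] :
    Representation ℂ (L ≃ₐ[ℚ] L) (ℂ ⊗[ℤ] (E.baseChange L).toAffine.Point) where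
  toFun σ := LinearMap.baseChange ℂ (galLin E σ)
  map_one' := by rw [galLin_one, LinearMap.baseChange_id]; rfl
  map_mul' σ τ := by rw [galLin_mul, LinearMap.baseChange_comp]; rfl

/-- The multiplicity `⟨ρ, E(K)_ℂ⟩`. -/
def multiplicity (E : WeierstrassCurve ℚ) (K : IntermediateField ℚ Qbar) [FiniteDimensional ℚ K]
    {V : Type*} [AddCommGroup V] [Module ℂ V] (ρ : Representation ℂ (K ≃ₐ[ℚ] K) V) : ℂ :=
  charInner ρ.character (mordellWeil E K).character

/-! ### Conductors -/

section Conductors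

/-- A prime of `K` above `p`. -/
def primeAbove (K : IntermediateField ℚ Qbar) (p : ℕ) : Ideal (𝓞 K) :=
  Classical.epsilon fun P => P.IsPrime ∧ (p : 𝓞 K) ∈ P

/-- The `i`-th ramification group (in the lower numbering) at a prime of `K` above `p`:
those `σ` with `σ x ≡ x mod P^(i+1)` for all integers `x` of `K`. -/
def ramificationGroup (K : IntermediateField ℚ Qbar) (p i : ℕ) : Subgroup (K ≃ₐ[ℚ] K) :=
  (Submodule.toAddSubgroup (primeAbove K p ^ (i + 1))).inertia (K ≃ₐ[ℚ] K)

variable {V : Type*} [AddCommGroup V] [Module ℂ V]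

/-- The exponent of `p` in the Artin conductor,
`∑_{i ≥ 0} |G_i| / |G_0| · codim V^{G_i}`; the division is exact. -/
def artinExponent (K : IntermediateField ℚ Qbar) (ρ : Representation ℂ (K ≃ₐ[ℚ] K) V) (p : ℕ) : ℕ :=
  (∑ᶠ i : ℕ, Nat.card (ramificationGroup K p i) *
    (Module.finrank ℂ V - Module.finrank ℂ
      (Representation.invariants (ρ.comp (ramificationGroup K p i).subtype)))) /
    Nat.card (ramificationGroup K p 0)

/-- The Artin conductor of a representation of `Gal(K/ℚ)`. -/
def artinConductor (K : IntermediateField ℚ Qbar) (ρ : Representation ℂ (K ≃ₐ[ℚ] K) V) : ℕ :=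
  ∏ᶠ p : Nat.Primes, (p : ℕ) ^ artinExponent K ρ p

variable (E : WeierstrassCurve ℚ)

/-- The field `ℚ(E[ℓ])`. -/
def torsionField (l : ℕ) : IntermediateField ℚ Qbar :=
  IntermediateField.adjoin ℚ {a | ∃ (x y : Qbar) (h : (E.baseChange Qbar).toAffine.Nonsingular x y),
    l • WeierstrassCurve.Affine.Point.some x y h = 0 ∧ (a = x ∨ a = y)}

/-- The dimension over `𝔽_ℓ` of the part of `E[ℓ]` fixed by the `i`-th ramification group of
`ℚ(E[ℓ])` at `p`. -/
def fixedTorsionDim (l p i : ℕ) : ℕ :=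
  Nat.log l (Nat.card {P : (E.baseChange (torsionField E l)).toAffine.Point //
    l • P = 0 ∧ ∀ σ ∈ ramificationGroup (torsionField E l) p i, galPoint E σ P = P})

/-- The wild part `∑_{i ≥ 1} |G_i| / |G_0| · dim E[ℓ] / E[ℓ]^{G_i}` of the conductor exponent,
computed in `ℚ(E[ℓ])` with a prime `ℓ ≠ p`; the division is exact. -/
def wildExponent (p : ℕ) : ℕ :=
  let l := if p = 3 then 5 else 3
  (∑ᶠ i : ℕ, Nat.card (ramificationGroup (torsionField E l) p (i + 1)) *
    (2 - fixedTorsionDim E l p (i + 1))) / Nat.card (ramificationGroup (torsionField E l) p 0)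

/-- `E` has good reduction at `p`. -/
def GoodAt (p : ℕ) [Fact p.Prime] : Prop :=
  ((E.baseChange ℚ_[p]).minimal ℤ_[p]).HasGoodReduction ℤ_[p]

/-- `E` has multiplicative reduction at `p`. -/
def MultiplicativeAt (p : ℕ) [Fact p.Prime] : Prop :=
  ((E.baseChange ℚ_[p]).minimal ℤ_[p]).HasMultiplicativeReduction ℤ_[p]

/-- The exponent of `p` in the conductor of `E`. -/
def conductorExponent (p : ℕ) [Fact p.Prime] : ℕ :=
  (if GoodAt E p then 0 else if MultiplicativeAt E p then 1 else 2) + wildExponent E p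

/-- The conductor of `E`. -/
def conductor : ℕ :=
  ∏ᶠ p : Nat.Primes, (p : ℕ) ^ (haveI : Fact (p : ℕ).Prime := ⟨p.2⟩; conductorExponent E p)

/-- `E` is semistable: it has good or multiplicative reduction at every prime. -/
def IsSemistable : Prop := ∀ (p : ℕ) [Fact p.Prime], GoodAt E p ∨ MultiplicativeAt E p

/-- A group homomorphism `E(ℚ̄) → E'(ℚ̄)` is an isogeny over `ℚ`: it is non-zero and, off a finite
set of points, given by rational functions `(f / h, g / h)` with rational coefficients. -/
def IsIsogeny (E' : WeierstrassCurve ℚ)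
    (φ : (E.baseChange Qbar).toAffine.Point →+ (E'.baseChange Qbar).toAffine.Point) : Prop :=
  φ ≠ 0 ∧ ∃ f g h : MvPolynomial (Fin 2) ℚ,
    {P | ¬ ∃ (x y : Qbar) (hP : (E.baseChange Qbar).toAffine.Nonsingular x y)
      (hQ : (E'.baseChange Qbar).toAffine.Nonsingular
        (MvPolynomial.aeval ![x, y] f / MvPolynomial.aeval ![x, y] h)
        (MvPolynomial.aeval ![x, y] g / MvPolynomial.aeval ![x, y] h)),
      MvPolynomial.aeval ![x, y] h ≠ 0 ∧ P = .some x y hP ∧ φ P = .some _ _ hQ}.Finite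

/-- `E` has no non-trivial isogenies over `ℚ`: every isogeny from `E` over `ℚ` has the kernel
`E[n]` of a multiplication map, that is, it is `[n]` followed by an isomorphism. -/
def HasNoNontrivialIsogenies : Prop :=
  ∀ (E' : WeierstrassCurve ℚ) [E'.IsElliptic]
    (φ : (E.baseChange Qbar).toAffine.Point →+ (E'.baseChange Qbar).toAffine.Point),
    IsIsogeny E E' φ → ∃ n : ℕ, n ≠ 0 ∧ ∀ P, φ P = 0 ↔ n • P = 0

/-- The condition on `E` and `ρ` under which integrality is predicted. -/
def IntegralityCondition (K : IntermediateField ℚ Qbar) (ρ : Representation ℂ (K ≃ₐ[ℚ] K) V) :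
    Prop :=
  Nat.Coprime (conductor E) (artinConductor K ρ) ∨ (IsSemistable E ∧ HasNoNontrivialIsogenies E)

end Conductors

/-! ### The conjecture on the invariants `BSD(E, ρ)` -/

section Conjecture

instance numberField (K : IntermediateField ℚ Qbar) [h : FiniteDimensional ℚ K] : NumberField K where
  to_finiteDimensional := by
    convert h

variable (E : WeierstrassCurve ℚ) (B : ArtinRep → ℂˣ)

/-- `B` depends only on the isomorphism class of the representation. -/
def IsoInvariant : Prop :=
  ∀ ρ τ : ArtinRep, Nonempty (ρ.ρ.Equiv τ.ρ) → B ρ = B τ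

/-- `BSD(E/K) = BSD(E, Ind_{K/ℚ} 1)` for every number field `K`, and `Ш(E/K)` is finite. -/
def C1 : Prop :=
  ∀ (K : IntermediateField ℚ Qbar) [FiniteDimensional ℚ K],
    ((BSDQuotient E K : ℝ) : ℂ) = B (ArtinRep.ind K) ∧ Finite (Sha (E.baseChange K))

/-- `BSD(E, ρ ⊕ τ) = BSD(E, ρ) BSD(E, τ)`. -/
def C2 : Prop :=
  ∀ ρ τ : ArtinRep, B (ρ.sum τ) = B ρ * B τ

/-- If `⟨ρ, E(K)_ℂ⟩ = 0`, then `BSD(E, ρ) ∈ ℚ(ρ)ˣ` and `BSD(E, ρ^s) = BSD(E, ρ)^s` for all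
`s ∈ Gal(ℚ(ρ)/ℚ)`, where `ρ^s` is any Artin representation with character `s ∘ Tr ρ`. -/
def C5 : Prop :=
  ∀ (K : IntermediateField ℚ Qbar) [FiniteDimensional ℚ K] [IsGalois ℚ K] (V : Type)
    [AddCommGroup V] [Module ℂ V] [FiniteDimensional ℂ V] (ρ : Representation ℂ (K ≃ₐ[ℚ] K) V),
    multiplicity E K ρ = 0 →
    ∃ b : charField ρ, (b : ℂ) = B (ArtinRep.inflate K ρ) ∧
      ∀ (s : charField ρ ≃ₐ[ℚ] charField ρ) (τ : ArtinRep),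
        (∀ g : GQ, τ.ρ.character g = s (charValue ρ (AlgEquiv.restrictNormalHom K g))) →
        (B τ : ℂ) = s b

/-- If `⟨ρ, E(K)_ℂ⟩ = 0` and `ρ` is a non-trivial one-dimensional character of order `d`, then
`BSD(E, ρ) ∈ ℤ[ζ_d]`, provided that the conductors of `E` and `ρ` are coprime or `E` is semistable
without non-trivial isogenies. Primitive Dirichlet characters are identified with one-dimensional
Artin representations over `ℚ`. -/
def C6 : Prop :=
  ∀ (K : IntermediateField ℚ Qbar) [FiniteDimensional ℚ K] [IsGalois ℚ K] (V : Type)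
    [AddCommGroup V] [Module ℂ V] [FiniteDimensional ℂ V] (ρ : Representation ℂ (K ≃ₐ[ℚ] K) V),
    multiplicity E K ρ = 0 → Module.finrank ℂ V = 1 → ¬ ρ.IsTrivial → IntegralityCondition E K ρ →
    (B (ArtinRep.inflate K ρ) : ℂ) ∈ cyclotomicInt (orderOf ρ.character)

/-- There are invariants `BSD(E, ρ) ∈ ℂˣ` with the properties C1, C2 and C5. -/
def Conjecture125 : Prop :=
  ∃ B : ArtinRep → ℂˣ, IsoInvariant B ∧ C1 E B ∧ C2 B ∧ C5 E B

/-- There are invariants `BSD(E, ρ) ∈ ℂˣ` with the properties C1, C2, C5 and C6. -/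
def Conjecture1256 : Prop :=
  ∃ B : ArtinRep → ℂˣ, IsoInvariant B ∧ C1 E B ∧ C2 B ∧ C5 E B ∧ C6 E B

/-- The subfield `F^H` of `F`, where `H` is a subgroup of `G ≃ Gal(F/ℚ)`. -/
def fixedSubfield {G : Type*} [Group G] {F : IntermediateField ℚ Qbar} (e : (F ≃ₐ[ℚ] F) ≃* G)
    (H : Subgroup G) : IntermediateField ℚ Qbar :=
  IntermediateField.lift (IntermediateField.fixedField (H.comap e.toMonoidHom))

instance finiteDimensional_fixedSubfield {G : Type*} [Group G] {F : IntermediateField ℚ Qbar}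
    [FiniteDimensional ℚ F] (e : (F ≃ₐ[ℚ] F) ≃* G) (H : Subgroup G) :
    FiniteDimensional ℚ (fixedSubfield e H) :=
  Module.Finite.equiv (IntermediateField.liftAlgEquiv
    (IntermediateField.fixedField (H.comap e.toMonoidHom))).toLinearEquiv

end Conjecture

end BSDTwist

end

/-! The invariants turn sums of characters into products of numbers. A complex representation of a
finite group is determined by its character, so an isomorphism-invariant `B` that is multiplicative
on direct sums sends every additive relation between characters of Artin representations to a
multiplicative relation between values of `B` (`prod_eq_prod_of_sum_character_eq`).

Apply this to the given relation, with negative terms moved to the other side so that both sides are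
genuine representations. Inflating `Ind_H^G 1` to the absolute Galois group gives `Ind 1` from the
fixed field of `H`, so C1 turns these terms into BSD quotients. With `x = B(ρ)`, C5 says that `x`
lies in `ℚ(ρ)` and that the conjugate `ρ^s` contributes `s x`. As `ℚ(ρ)` lies in a cyclotomic field
it is Galois over `ℚ`, and the conjugates multiply to the norm of `x`. That `ρ^s` exists as a
representation is seen by extending `s` to an endomorphism of `ℂ` and applying it to matrix entries.

C5 needs multiplicity zero, so the alternative "positive or zero" must be exhaustive. The
multiplicity is a dimension once `E(F) ⊗ ℂ` is finite-dimensional, and the Mordell–Weil theorem is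
not needed for that: by C1 the BSD quotient is a value of `B`, hence non-zero, whereas the regulator
would be `0` without a Mordell–Weil basis.

For abelian `G`, `ρ` is one-dimensional and C6 puts the same `x` in `ℤ[ζ_n]`, where the order `n` of
the character divides the exponent of `G`. -/

namespace Representation

variable {k G : Type*} [Field k] [Group G]

/-! ### Representations of finite groups are determined by their characters -/

section Character

variable {V W U : Type*} [AddCommGroup V] [Module k V] [AddCommGroup W] [Module k W]
  [AddCommGroup U] [Module k U]

theorem char_prod [FiniteDimensional k V] [FiniteDimensional k W] (ρ : Representation k G V)
    (σ : Representation k G W) (g : G) :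
    (ρ.prod σ).character g = ρ.character g + σ.character g :=
  LinearMap.trace_prodMap' _ _

/-- A representation is the direct sum of two complementary subrepresentations. -/
noncomputable def prodEquivOfIsCompl {ρ : Representation k G V} {p q : Subrepresentation ρ}
    (h : IsCompl p q) : (p.toRepresentation.prod q.toRepresentation).Equiv ρ :=
  .mk (Submodule.prodEquivOfIsCompl p.toSubmodule q.toSubmodule <| by
      refine IsCompl.of_eq ?_ ?_
      · rw [← Subrepresentation.toSubmodule_inf, h.inf_eq_bot]; rfl
      · rw [← Subrepresentation.toSubmodule_sup, h.sup_eq_top]; rfl) fun g => by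
    ext x <;> simp [Subrepresentation.toRepresentation]

/-- Direct sums of equivalences of representations. -/
noncomputable def Equiv.prodCongr {X : Type*} [AddCommGroup X] [Module k X]
    {ρ : Representation k G V} {σ : Representation k G W} {τ : Representation k G U}
    {υ : Representation k G X} (φ : ρ.Equiv σ) (ψ : τ.Equiv υ) : (ρ.prod τ).Equiv (σ.prod υ) :=
  .mk (φ.toLinearEquiv.prodCongr ψ.toLinearEquiv) fun g => by
    ext x
    · exact φ.toIntertwiningMap.isIntertwining _ _ g x
    · simp
    · simp
    · exact ψ.toIntertwiningMap.isIntertwining _ _ g x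

/-- An intertwining map identifies a complement of its kernel with its range. -/
noncomputable def IntertwiningMap.complEquivRange {ρ : Representation k G V}
    {σ : Representation k G W} (f : ρ.IntertwiningMap σ) {q : Subrepresentation ρ}
    (h : IsCompl f.ker q) : q.toRepresentation.Equiv f.range.toRepresentation :=
  .mk (LinearEquiv.ofBijective
    ((f.toLinearMap.domRestrict q.toSubmodule).codRestrict f.range.toSubmodule
      fun x => ⟨x.1, rfl⟩) <| by
    constructor
    · rw [← LinearMap.ker_eq_bot, eq_bot_iff]
      rintro ⟨x, hx⟩ hx'
      have h1 : x ∈ f.ker ⊓ q := ⟨congrArg Subtype.val hx', hx⟩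
      rw [h.inf_eq_bot] at h1
      exact Subtype.ext h1
    · rintro ⟨_, x, rfl⟩
      obtain ⟨⟨a, b⟩, rfl⟩ := (prodEquivOfIsCompl h).toLinearEquiv.surjective x
      refine ⟨b, Subtype.ext ?_⟩
      have ha : f a.1 = 0 := a.2
      change f b.1 = f (a.1 + b.1)
      rw [map_add, ha, zero_add]) fun g => by
    ext x
    exact f.isIntertwining _ _ g x.1

end Character

/-- Over a field of characteristic zero, a representation of a finite group is determined by its
character. -/
theorem nonempty_equiv_of_character_eq [CharZero k] [Finite G] {V W : Type*} [AddCommGroup V]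
    [Module k V] [FiniteDimensional k V] [AddCommGroup W] [Module k W] [FiniteDimensional k W]
    (ρ : Representation k G V) (σ : Representation k G W) (h : ρ.character = σ.character) :
    Nonempty (ρ.Equiv σ) := by
  induction hn : Module.finrank k V using Nat.strong_induction_on generalizing V W with
  | _ n ih =>
    have hd : Module.finrank k V = Module.finrank k W := by
      have := congrFun h 1
      rw [char_one, char_one] at this
      exact_mod_cast this
    rcases Nat.eq_zero_or_pos n with h0 | h0
    · have hV := Module.finrank_zero_iff.mp (hn.trans h0)
      have hW := Module.finrank_zero_iff.mp (hd.symm.trans (hn.trans h0))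
      exact ⟨.mk (LinearEquiv.ofFinrankEq V W hd) fun g => LinearMap.ext fun _ =>
        Subsingleton.elim _ _⟩
    have : Fintype G := Fintype.ofFinite G
    have hcard : (Nat.card G : k) ≠ 0 := by exact_mod_cast Nat.card_pos.ne'
    have : NeZero (Nat.card G : k) := ⟨hcard⟩
    -- Induction on dimension, without splitting into irreducibles. `Hom(ρ, σ)` has the dimension of
    -- `End ρ`, as both are the same character sum; so it contains some `f ≠ 0`. The complement of
    -- `ker f` is isomorphic to the range of `f`; cancelling the two leaves `ker f` and a complement
    -- of the range, with equal characters and smaller dimension.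
    have : Invertible (Nat.card G : k) := invertibleOfNonzero hcard
    have h1 : Module.finrank k (IntertwiningMap ρ σ) = Module.finrank k (IntertwiningMap ρ ρ) := by
      have h1 := card_inv_mul_sum_char_mul_char_eq_finrank ρ σ
      rw [← h, card_inv_mul_sum_char_mul_char_eq_finrank ρ ρ] at h1
      exact_mod_cast h1.symm
    have hVn : Nontrivial V := Module.finrank_pos_iff.mp (hn ▸ h0)
    have h2 : ∃ f : IntertwiningMap ρ σ, f ≠ 0 := by
      by_contra! hf
      have : Subsingleton (IntertwiningMap ρ σ) := ⟨fun a b => by rw [hf a, hf b]⟩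
      rw [Module.finrank_zero_of_subsingleton] at h1
      have hfin : Module.Finite k (IntertwiningMap ρ ρ) :=
        Module.Finite.equiv (invariantsEquivIntertwiningMap ρ ρ)
      have := Module.finrank_zero_iff.mp h1.symm
      obtain ⟨v, hv⟩ := exists_ne (0 : V)
      exact hv (congrArg (fun f : IntertwiningMap ρ ρ => f v)
        (Subsingleton.elim (IntertwiningMap.id ρ) 0))
    obtain ⟨f, hf⟩ := h2
    obtain ⟨q, hq⟩ := exists_isCompl f.ker
    obtain ⟨r, hr⟩ := exists_isCompl f.range
    have e1 := f.complEquivRange hq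
    have hchar : f.ker.toRepresentation.character = r.toRepresentation.character := by
      ext g
      have a1 := congrFun (char_iso (prodEquivOfIsCompl hq)) g
      have a2 := congrFun (char_iso (prodEquivOfIsCompl hr)) g
      have a3 := congrFun (char_iso e1) g
      rw [char_prod] at a1 a2
      rw [h] at a1
      linear_combination a1 - a2 - a3
    have hlt : Module.finrank k f.ker.toSubmodule < n := by
      rw [← hn]
      refine Submodule.finrank_lt fun htop => hf ?_
      ext v
      have : v ∈ f.ker.toSubmodule := htop ▸ Submodule.mem_top
      exact this
    obtain ⟨e2⟩ := ih _ hlt f.ker.toRepresentation r.toRepresentation hchar rfl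
    refine ⟨(prodEquivOfIsCompl hq).symm.trans ((e2.prodCongr e1).trans ?_)⟩
    exact prodEquivOfIsCompl hr.symm

end Representation

/-! ### Extending field endomorphisms to an algebraically closed field -/

/-- An injective ring homomorphism to an algebraically closed field extends to algebraic
extensions. -/
theorem IsAlgClosed.exists_ringHom_comp_algebraMap_eq {A S M : Type*} [CommRing A] [IsDomain A]
    [Field S] [Algebra A S] [FaithfulSMul A S] [Algebra.IsAlgebraic A S] [Field M] [IsAlgClosed M]
    (f : A →+* M) (hf : Function.Injective f) :
    ∃ g : S →+* M, g.comp (algebraMap A S) = f := by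
  let _ : Algebra A M := f.toAlgebra
  have : FaithfulSMul A M := (faithfulSMul_iff_algebraMap_injective A M).mpr hf
  exact ⟨(IsAlgClosed.lift : S →ₐ[A] M), (IsAlgClosed.lift : S →ₐ[A] M).comp_algebraMap⟩

/-- An endomorphism of a field extends to every algebraically closed extension field. -/
theorem IsAlgClosed.exists_ringHom_extend {L M : Type*} [Field L] [Field M] [Algebra L M]
    [IsAlgClosed M] (s : L →+* L) :
    ∃ f : M →+* M, ∀ x, f (algebraMap L M x) = algebraMap L M (s x) := by
  obtain ⟨ι, x, hx⟩ := exists_isTranscendenceBasis' L M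
  have halg := hx.isAlgebraic
  -- On the polynomial ring `L[x]` over a transcendence basis, `φ` applies `s` to the coefficients
  -- and fixes the variables. It is injective and `M` is algebraic over `L[x]`, so it extends to
  -- `M`.
  let φ : Algebra.adjoin L (Set.range x) →+* M :=
    ((MvPolynomial.aeval x : MvPolynomial ι L →ₐ[L] M) : MvPolynomial ι L →+* M).comp
      ((MvPolynomial.map s).comp
        (hx.1.aevalEquiv.symm : Algebra.adjoin L (Set.range x) →+* MvPolynomial ι L))
  have hφ : Function.Injective φ :=
    (show Function.Injective (MvPolynomial.aeval x : MvPolynomial ι L →ₐ[L] M) from hx.1).comp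
      ((MvPolynomial.map_injective s s.injective).comp hx.1.aevalEquiv.symm.injective)
  obtain ⟨f, hf⟩ := IsAlgClosed.exists_ringHom_comp_algebraMap_eq (S := M) φ hφ
  refine ⟨f, fun a => ?_⟩
  have := RingHom.congr_fun hf (algebraMap L _ a)
  simpa [φ] using! this

/-! ### Galois conjugates of representations and the field of character values -/

namespace Representation

/-- The representation obtained by applying a field homomorphism to the matrix entries of a
representation in a basis. -/
noncomputable def mapMatrix {k k' G V : Type*} [Field k] [Field k'] [Group G] [AddCommGroup V]
    [Module k V] {n : ℕ} (b : Module.Basis (Fin n) k V) (f : k →+* k') (ρ : Representation k G V) :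
    Representation k' G (Fin n → k') :=
  ((Matrix.toLinAlgEquiv' : Matrix (Fin n) (Fin n) k' ≃ₐ[k'] _) :
      Matrix (Fin n) (Fin n) k' →* Module.End k' (Fin n → k')).comp
    (((f.mapMatrix : Matrix (Fin n) (Fin n) k →+* Matrix (Fin n) (Fin n) k') :
        Matrix (Fin n) (Fin n) k →* Matrix (Fin n) (Fin n) k').comp
      (((LinearMap.toMatrixAlgEquiv b) : Module.End k V →* Matrix (Fin n) (Fin n) k).comp ρ))

theorem character_mapMatrix {k k' G V : Type*} [Field k] [Field k'] [Group G] [AddCommGroup V]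
    [Module k V] {n : ℕ} (b : Module.Basis (Fin n) k V) (f : k →+* k') (ρ : Representation k G V)
    (g : G) : (ρ.mapMatrix b f).character g = f (ρ.character g) := by
  change LinearMap.trace k' _ (Matrix.toLin' (f.mapMatrix (LinearMap.toMatrix b b (ρ g)))) = _
  rw [Matrix.trace_toLin'_eq, character, LinearMap.trace_eq_matrix_trace k b]
  simp [Matrix.trace]

variable {G V : Type*} [Group G] [Finite G] [AddCommGroup V] [Module ℂ V] [FiniteDimensional ℂ V]

/-- Character values of a finite group lie in a cyclotomic field. -/
theorem character_mem_adjoin (ρ : Representation ℂ G V) (g : G) :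
    ρ.character g ∈
      IntermediateField.adjoin ℚ {x : ℂ | ∃ n ∈ ({Nat.card G} : Set ℕ), n ≠ 0 ∧ x ^ n = 1} := by
  -- The trace is the sum of the eigenvalues, each a root of unity of order dividing `|G|`.
  rw [character, Module.End.trace_eq_sum_roots_charpoly_of_splits (IsAlgClosed.splits _)]
  refine multiset_sum_mem _ fun μ hμ => ?_
  have hμ' : Module.End.HasEigenvalue (ρ g) μ :=
    (Module.End.hasEigenvalue_iff_isRoot_charpoly _ _).mpr (Polynomial.isRoot_of_mem_roots hμ)
  obtain ⟨v, hv⟩ := hμ'.exists_hasEigenvector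
  have h1 := hv.pow_apply (Nat.card G)
  rw [← map_pow, pow_card_eq_one', map_one, Module.End.one_apply] at h1
  have h2 : μ ^ Nat.card G = 1 := by
    have : (μ ^ Nat.card G - 1) • v = 0 := by rw [sub_smul, one_smul, ← h1, sub_self]
    exact sub_eq_zero.mp ((smul_eq_zero.mp this).resolve_right hv.2)
  exact IntermediateField.subset_adjoin _ _ ⟨_, rfl, Nat.card_pos.ne', h2⟩

end Representation

namespace BSDTwist

variable {G V : Type*} [Group G] [AddCommGroup V] [Module ℂ V]

/-- Every subextension of the abelian extension generated by the `|G|`-th roots of unity is itself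
Galois and abelian. This makes the sum over `Gal(ℚ(ρ)/ℚ)` finite and the norm a product over
automorphisms. -/
theorem isAbelianGalois_charField [Finite G] [FiniteDimensional ℂ V] (ρ : Representation ℂ G V) :
    FiniteDimensional ℚ (charField ρ) ∧ IsAbelianGalois ℚ (charField ρ) := by
  set L := IntermediateField.adjoin ℚ {x : ℂ | ∃ n ∈ ({Nat.card G} : Set ℕ), n ≠ 0 ∧ x ^ n = 1}
  have hle : charField ρ ≤ L := by
    rw [IntermediateField.adjoin_le_iff]
    rintro _ ⟨g, rfl⟩
    exact ρ.character_mem_adjoin g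
  have : IsCyclotomicExtension {Nat.card G} ℚ L :=
    IntermediateField.isCyclotomicExtension_adjoin_of_exists_isPrimitiveRoot _ ℚ ℂ
      fun n _ h0 => ⟨_, Complex.isPrimitiveRoot_exp n h0⟩
  have := IsCyclotomicExtension.finiteDimensional {Nat.card G} ℚ L
  have := IsCyclotomicExtension.isAbelianGalois {Nat.card G} ℚ L
  exact ⟨Module.Finite.of_injective (IntermediateField.inclusion hle).toLinearMap
    (IntermediateField.inclusion hle).injective,
    IsAbelianGalois.of_algHom (IntermediateField.inclusion hle)⟩

/-- Every Galois conjugate of the character of a representation is again a character. -/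
theorem exists_galoisConjugate [FiniteDimensional ℂ V] (ρ : Representation ℂ G V)
    (s : charField ρ ≃ₐ[ℚ] charField ρ) :
    ∃ (n : ℕ) (τ : Representation ℂ G (Fin n → ℂ)), ∀ g, τ.character g = s (charValue ρ g) := by
  -- The matrix entries of `ρ` need not lie in `ℚ(ρ)`, so `s` has to be extended to all of `ℂ`.
  obtain ⟨f, hf⟩ := IsAlgClosed.exists_ringHom_extend (M := ℂ)
    (s : charField ρ →+* charField ρ)
  exact ⟨_, ρ.mapMatrix (Module.finBasis ℂ V) f, fun g =>
    (ρ.character_mapMatrix _ f g).trans (hf (charValue ρ g))⟩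

end BSDTwist

/-! ### Induction from fixed fields -/

namespace BSDTwist

/-- Permutation representations on cosets are compatible with pullback along a surjection. -/
noncomputable def indOneComapEquiv {Γ G : Type*} [Group Γ] [Group G] (φ : Γ →* G)
    (hφ : Function.Surjective φ) (H : Subgroup G) :
    (indOne (H.comap φ)).Equiv ((indOne H).comp φ) := by
  let q : Γ ⧸ H.comap φ → G ⧸ H := Quotient.map' φ fun a b h => by
    rw [QuotientGroup.leftRel_apply] at h ⊢
    simpa using h
  have hq : Function.Bijective q := by
    constructor
    · intro a b
      induction a using QuotientGroup.induction_on with | H a =>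
      induction b using QuotientGroup.induction_on with | H b =>
      intro h
      have h' : ((φ a : G) : G ⧸ H) = (φ b : G) := h
      rw [QuotientGroup.eq] at h' ⊢
      simpa using h'
    · intro a
      induction a using QuotientGroup.induction_on with | H a =>
      obtain ⟨b, rfl⟩ := hφ a
      exact ⟨(b : Γ ⧸ H.comap φ), rfl⟩
  have hsmul : ∀ (g : Γ) (x : Γ ⧸ H.comap φ), q (g • x) = φ g • q x := by
    intro g x
    induction x using QuotientGroup.induction_on with | H x =>
    exact congrArg (QuotientGroup.mk (s := H)) (map_mul φ g x)
  refine .mk ((MonoidAlgebra.coeffLinearEquiv ℂ).trans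
    ((Finsupp.domLCongr (Equiv.ofBijective q hq)).trans
      (MonoidAlgebra.coeffLinearEquiv ℂ).symm)) fun g => ?_
  ext x
  simp [hsmul]

section Galois

variable {G : Type*} [Group G] {F : IntermediateField ℚ Qbar} [FiniteDimensional ℚ F] [IsGalois ℚ F]
  (e : (F ≃ₐ[ℚ] F) ≃* G)

/-- The surjection from the absolute Galois group onto `G ≃ Gal(F/ℚ)`. -/
noncomputable abbrev galProj : GQ →* G := e.toMonoidHom.comp (AlgEquiv.restrictNormalHom F)

omit [FiniteDimensional ℚ F] in
theorem galProj_surjective : Function.Surjective (galProj e) :=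
  e.surjective.comp (AlgEquiv.restrictNormalHom_surjective Qbar)

/-- The Galois correspondence inside `F`, pulled back along restriction from the absolute Galois
group to `F`. -/
theorem fixingSubgroup_fixedSubfield (H : Subgroup G) :
    (fixedSubfield e H).fixingSubgroup = H.comap (galProj e) := by
  have h : (IntermediateField.fixedField (H.comap e.toMonoidHom)).fixingSubgroup =
    H.comap e.toMonoidHom := IntermediateField.fixingSubgroup_fixedField _
  rw [← Subgroup.comap_comap, ← h]
  ext σ
  rw [IntermediateField.mem_fixingSubgroup_iff, Subgroup.mem_comap,
    IntermediateField.mem_fixingSubgroup_iff]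
  constructor
  · intro hσ x hx
    apply Subtype.ext
    exact (AlgEquiv.restrictNormal_commutes σ F x).trans
      (hσ x ((IntermediateField.mem_lift x).mpr hx))
  · intro hσ x hx
    have hxF : x ∈ F := IntermediateField.lift_le _ hx
    have := hσ ⟨x, hxF⟩ ((IntermediateField.mem_lift (⟨x, hxF⟩ : F)).mp hx)
    exact (AlgEquiv.restrictNormal_commutes σ F ⟨x, hxF⟩).symm.trans (congrArg Subtype.val this)

theorem character_ind_fixedSubfield (H : Subgroup G) (σ : GQ) :
    (ArtinRep.ind (fixedSubfield e H)).ρ.character σ = (indOne H).character (galProj e σ) := by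
  change (indOne (fixedSubfield e H).fixingSubgroup).character σ = _
  rw [fixingSubgroup_fixedSubfield]
  exact congrFun (Representation.char_iso (indOneComapEquiv _ (galProj_surjective e) H)) σ

end Galois

/-! ### From character relations to relations between values of `B` -/

section Artin

/-- Artin representations with the same character are isomorphic. -/
theorem ArtinRep.nonempty_equiv_of_character_eq (ρ τ : ArtinRep)
    (h : ∀ σ, ρ.ρ.character σ = τ.ρ.character σ) : Nonempty (ρ.ρ.Equiv τ.ρ) := by
  obtain ⟨K, hK, hK', h1⟩ := ρ.factors
  obtain ⟨L, hL, hL', h2⟩ := τ.factors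
  -- Both representations factor through the finite quotient by `N`, which belongs to the compositum
  -- of the two fields. Written as a kernel, `N` is visibly normal.
  let N : Subgroup GQ := (AlgEquiv.restrictNormalHom (F := ℚ) (K₁ := Qbar)
    (K ⊔ L : IntermediateField ℚ Qbar)).ker
  have hN : N = (K ⊔ L).fixingSubgroup := IntermediateField.restrictNormalHom_ker _
  have : Finite (GQ ⧸ N) := by rw [hN]; infer_instance
  have h1' : ∀ σ ∈ N, ρ.ρ σ = 1 := fun σ hσ =>
    h1 σ (IntermediateField.fixingSubgroup_antitone le_sup_left (hN ▸ hσ))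
  have h2' : ∀ σ ∈ N, τ.ρ σ = 1 := fun σ hσ =>
    h2 σ (IntermediateField.fixingSubgroup_antitone le_sup_right (hN ▸ hσ))
  let ρ' : Representation ℂ (GQ ⧸ N) ρ.V := QuotientGroup.lift N ρ.ρ h1'
  let τ' : Representation ℂ (GQ ⧸ N) τ.V := QuotientGroup.lift N τ.ρ h2'
  obtain ⟨φ⟩ := Representation.nonempty_equiv_of_character_eq ρ' τ' <| by
    ext q
    induction q using QuotientGroup.induction_on with | H g => exact h g
  exact ⟨.mk φ.toLinearEquiv fun g => φ.toIntertwiningMap.isIntertwining' (g : GQ ⧸ N)⟩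

/-- The zero Artin representation. -/
noncomputable def ArtinRep.zero : ArtinRep where
  V := PUnit
  ρ := Representation.trivial ℂ GQ PUnit
  factors := ⟨⊥, inferInstance, inferInstance, fun _ _ => rfl⟩

variable {B : ArtinRep → ℂˣ} (hiso : IsoInvariant B) (hC2 : C2 B)
include hiso hC2

/-- From `0 ⊕ 0 ≅ 0` the unit `B 0` equals its own square. It is the empty product in
`exists_finset_sum`. -/
theorem apply_zero_eq_one : B ArtinRep.zero = 1 := by
  have h : B (ArtinRep.zero.sum ArtinRep.zero) = B ArtinRep.zero :=
    hiso _ _ <| ArtinRep.nonempty_equiv_of_character_eq _ _ fun σ => by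
      have h0 : ArtinRep.zero.ρ.character σ = 0 := by
        have : ArtinRep.zero.ρ σ = 0 := LinearMap.ext fun _ => rfl
        rw [Representation.character, this, map_zero]
      refine (Representation.char_prod _ _ σ).trans ?_
      rw [h0, add_zero]
  rw [hC2] at h
  exact mul_eq_left.mp h

/-- Finite direct sums of Artin representations, on which `B` is multiplicative. -/
theorem exists_finset_sum {ι : Type*} (f : ι → ArtinRep) (s : Finset ι) :
    ∃ T : ArtinRep, (∀ σ, T.ρ.character σ = ∑ i ∈ s, (f i).ρ.character σ) ∧
      B T = ∏ i ∈ s, B (f i) := by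
  classical
  induction s using Finset.induction_on with
  | empty =>
    refine ⟨ArtinRep.zero, fun σ => ?_, by rw [apply_zero_eq_one hiso hC2, Finset.prod_empty]⟩
    have : ArtinRep.zero.ρ σ = 0 := LinearMap.ext fun _ => rfl
    rw [Representation.character, this, map_zero, Finset.sum_empty]
  | insert a s ha ih =>
    obtain ⟨T, hT, hB⟩ := ih
    refine ⟨(f a).sum T, fun σ => ?_, by rw [hC2, hB, Finset.prod_insert ha]⟩
    rw [Finset.sum_insert ha, ← hT]
    exact Representation.char_prod _ _ σ

/-- An additive relation between characters gives a multiplicative relation between the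
values of `B`. -/
theorem prod_eq_prod_of_sum_character_eq {ι κ : Type*} [Fintype ι] [Fintype κ] (f : ι → ArtinRep)
    (f' : κ → ArtinRep)
    (h : ∀ σ, ∑ i, (f i).ρ.character σ = ∑ j, (f' j).ρ.character σ) :
    ∏ i, B (f i) = ∏ j, B (f' j) := by
  obtain ⟨T, hT, hB⟩ := exists_finset_sum hiso hC2 f Finset.univ
  obtain ⟨T', hT', hB'⟩ := exists_finset_sum hiso hC2 f' Finset.univ
  rw [← hB, ← hB']
  exact hiso _ _ <| ArtinRep.nonempty_equiv_of_character_eq _ _ fun σ => by rw [hT, hT', h]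

end Artin

end BSDTwist

namespace BSDTwist

/-! ### Finite-dimensionality of `E(K) ⊗ ℂ` and the multiplicity of `ρ` -/

section MordellWeil

open scoped TensorProduct Classical

/-- If the Mordell--Weil group has a basis modulo torsion, then `E(K) ⊗ ℂ` is
finite-dimensional. -/
theorem finiteDimensional_of_isMordellWeilBasis {K : Type*} [Field K] (W : WeierstrassCurve K)
    {n : ℕ} (P : Fin n → W.toAffine.Point) (hP : IsMordellWeilBasis W P) :
    FiniteDimensional ℂ (ℂ ⊗[ℤ] W.toAffine.Point) := by
  let S : Submodule ℂ (ℂ ⊗[ℤ] W.toAffine.Point) :=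
    Submodule.span ℂ (Set.range fun i => (1 : ℂ) ⊗ₜ[ℤ] P i)
  let φ : W.toAffine.Point →+ ℂ ⊗[ℤ] W.toAffine.Point :=
    (TensorProduct.mk ℤ ℂ W.toAffine.Point 1).toAddMonoidHom
  have hle : AddSubgroup.closure (Set.range P) ⊔ AddCommGroup.torsion W.toAffine.Point ≤
      S.toAddSubgroup.comap φ := by
    refine sup_le ((AddSubgroup.closure_le _).mpr ?_) fun t ht => ?_
    · rintro _ ⟨i, rfl⟩
      exact Submodule.subset_span ⟨i, rfl⟩
    -- Torsion dies after tensoring with `ℂ`, where `m` is invertible.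
    · obtain ⟨m, hm, hmt⟩ := isOfFinAddOrder_iff_nsmul_eq_zero.mp ht
      have hm0 : (m : ℂ) ≠ 0 := by exact_mod_cast hm.ne'
      have h0 : (m : ℂ) • φ t = 0 := by
        rw [Nat.cast_smul_eq_nsmul, ← map_nsmul, hmt, map_zero]
      rw [AddSubgroup.mem_comap, (smul_eq_zero.mp h0).resolve_left hm0]
      exact S.zero_mem
  rw [hP.2, top_le_iff] at hle
  have hS : Module.Finite ℂ S := Module.Finite.span_of_finite ℂ (Set.finite_range _)
  refine Module.Finite.of_surjective (M := S) S.subtype fun x => ?_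
  suffices hx : x ∈ S from ⟨⟨x, hx⟩, rfl⟩
  induction x using TensorProduct.induction_on with
  | zero => exact S.zero_mem
  | add x y hx hy => exact S.add_mem hx hy
  | tmul c Q =>
    have h1 : (1 : ℂ) ⊗ₜ[ℤ] Q ∈ S := by
      have : Q ∈ S.toAddSubgroup.comap φ := hle ▸ AddSubgroup.mem_top Q
      exact this
    have h2 := S.smul_mem c h1
    rwa [TensorProduct.smul_tmul', smul_eq_mul, mul_one] at h2

variable {E : WeierstrassCurve ℚ} {B : ArtinRep → ℂˣ}

/-- The regulator takes the default value `0` when no Mordell–Weil basis exists, so a non-zero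
quotient forces one. -/
theorem finiteDimensional_of_BSDQuotient_ne_zero {K : Type*} [Field K] [NumberField K]
    [hK : Algebra ℚ K] (h : BSDQuotient E K ≠ 0) :
    FiniteDimensional ℂ (ℂ ⊗[ℤ] (E.baseChange K).toAffine.Point) := by
  -- `BSDQuotient` is built on the canonical `ℚ`-algebra structure, which need not be syntactically
  -- that of an intermediate field.
  obtain rfl : hK = DivisionRing.toRatAlgebra := Subsingleton.elim _ _
  have hex : ∃ (n : ℕ) (P : Fin n → (E.baseChange K).toAffine.Point),
      IsMordellWeilBasis (E.baseChange K) P := by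
    by_contra hex
    exact h (by rw [BSDQuotient, regulator, dif_neg hex, zero_mul, zero_mul, zero_div])
  obtain ⟨n, P, hP⟩ := hex
  exact finiteDimensional_of_isMordellWeilBasis _ P hP

theorem BSDQuotient_ne_zero (hC1 : C1 E B) (K : IntermediateField ℚ Qbar)
    [FiniteDimensional ℚ K] : BSDQuotient E K ≠ 0 := fun h0 =>
  (B (ArtinRep.ind K)).ne_zero <| by rw [← (hC1 K).1, h0, Complex.ofReal_zero]

/-- The inner product of two characters is a natural number. -/
theorem exists_charInner_eq_natCast {G V W : Type*} [Group G] [Fintype G] [AddCommGroup V]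
    [Module ℂ V] [FiniteDimensional ℂ V] [AddCommGroup W] [Module ℂ W] [FiniteDimensional ℂ W]
    (ρ : Representation ℂ G V) (σ : Representation ℂ G W) :
    ∃ n : ℕ, charInner ρ.character σ.character = n := by
  have hcard : (Nat.card G : ℂ) ≠ 0 := by exact_mod_cast Nat.card_pos.ne'
  have : Invertible (Nat.card G : ℂ) := invertibleOfNonzero hcard
  refine ⟨Module.finrank ℂ (σ.IntertwiningMap ρ), ?_⟩
  rw [charInner, ← Nat.card_eq_fintype_card]
  exact Representation.card_inv_mul_sum_char_mul_char_eq_finrank σ ρ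

/-- The multiplicity is a complex number by definition; here it is a natural number, being the
dimension of a space of intertwining maps. -/
theorem multiplicity_pos_or_eq_zero (hC1 : C1 E B) (K : IntermediateField ℚ Qbar)
    [FiniteDimensional ℚ K] {V : Type*} [AddCommGroup V] [Module ℂ V] [FiniteDimensional ℂ V]
    (ρ : Representation ℂ (K ≃ₐ[ℚ] K) V) :
    0 < multiplicity E K ρ ∨ multiplicity E K ρ = 0 := by
  have := finiteDimensional_of_BSDQuotient_ne_zero (BSDQuotient_ne_zero hC1 K)
  obtain ⟨n, hn⟩ := exists_charInner_eq_natCast ρ (mordellWeil E K)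
  rw [multiplicity, hn]
  rcases Nat.eq_zero_or_pos n with h | h
  · exact Or.inr (by rw [h, Nat.cast_zero])
  · exact Or.inl (by exact_mod_cast h)

end MordellWeil

/-! ### The norm relation and integrality -/

section Main

variable {G : Type*} [Group G] [Finite G] {V : Type} [AddCommGroup V] [Module ℂ V]
  [FiniteDimensional ℂ V] {ρ : Representation ℂ G V} {ι κ : Type*} [Fintype ι] [Fintype κ]
  {E : WeierstrassCurve ℚ} {B : ArtinRep → ℂˣ} {F : IntermediateField ℚ Qbar}
  [FiniteDimensional ℚ F] [IsGalois ℚ F]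

omit [Finite G] [FiniteDimensional ℂ V] [FiniteDimensional ℚ F] [IsGalois ℚ F] in
theorem charField_comp_eq (e : (F ≃ₐ[ℚ] F) ≃* G) :
    charField (ρ.comp e.toMonoidHom) = charField ρ :=
  congrArg (IntermediateField.adjoin ℚ) (e.surjective.range_comp ρ.character)

/-- The character fields of `ρ` and of its pullback along `e` are equal but not definitionally so.
With a free `L` the equality can be substituted, and quantifying over `y` avoids naming character
values in a particular field. -/
theorem C5.exists_of_charField_eq (hC5 : C5 E B) {W : Type} [AddCommGroup W] [Module ℂ W]
    [FiniteDimensional ℂ W] {τ : Representation ℂ (F ≃ₐ[ℚ] F) W} (h0 : multiplicity E F τ = 0)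
    {L : IntermediateField ℚ ℂ} (hL : charField τ = L) :
    ∃ b : L, (b : ℂ) = B (ArtinRep.inflate F τ) ∧ ∀ (s : L ≃ₐ[ℚ] L) (T : ArtinRep),
      (∀ (σ : GQ) (y : L), (y : ℂ) = τ.character (AlgEquiv.restrictNormalHom F σ) →
        T.ρ.character σ = s y) → (B T : ℂ) = s b := by
  subst hL
  obtain ⟨b, hb, hs⟩ := hC5 F W τ h0
  exact ⟨b, hb, fun s T hT => hs s T fun σ => hT σ _ rfl⟩

omit [Finite G] in
/-- The Galois conjugates of a representation of `G ≃ Gal(F/ℚ)`, as Artin representations, and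
the values of `B` on them. -/
theorem exists_conjugates (hC5 : C5 E B) (e : (F ≃ₐ[ℚ] F) ≃* G)
    (h0 : multiplicity E F (ρ.comp e.toMonoidHom) = 0) :
    ∃ x : charField ρ, (x : ℂ) = B (ArtinRep.inflate F (ρ.comp e.toMonoidHom)) ∧
      ∃ T : (charField ρ ≃ₐ[ℚ] charField ρ) → ArtinRep, ∀ s,
        (∀ σ, (T s).ρ.character σ = s (charValue ρ (galProj e σ))) ∧ (B (T s) : ℂ) = s x := by
  obtain ⟨x, hx, hs⟩ := hC5.exists_of_charField_eq h0 (charField_comp_eq e)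
  refine ⟨x, hx, ?_⟩
  have key : ∀ s : charField ρ ≃ₐ[ℚ] charField ρ, ∃ T : ArtinRep,
      ∀ σ, T.ρ.character σ = s (charValue ρ (galProj e σ)) := fun s => by
    obtain ⟨n, τ, hτ⟩ := exists_galoisConjugate ρ s
    exact ⟨ArtinRep.inflate F (τ.comp e.toMonoidHom), fun σ => hτ (galProj e σ)⟩
  choose T hT using key
  refine ⟨T, fun s => ⟨hT s, hs s (T s) fun σ y hy => ?_⟩⟩
  rw [hT s, show y = charValue ρ (galProj e σ) from Subtype.ext hy]

theorem norm_eq_prod_conjugates (x : charField ρ) [Fintype (charField ρ ≃ₐ[ℚ] charField ρ)] :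
    ((Algebra.norm ℚ x : ℚ) : ℂ) = ∏ s : charField ρ ≃ₐ[ℚ] charField ρ, (s x : ℂ) := by
  obtain ⟨_, _⟩ := isAbelianGalois_charField ρ
  have h := congrArg (charField ρ).val (Algebra.norm_eq_prod_automorphisms ℚ x)
  rw [map_prod] at h
  have h2 : (charField ρ).val (algebraMap ℚ _ (Algebra.norm ℚ x)) =
      ((Algebra.norm ℚ x : ℚ) : ℂ) := by
    rw [AlgHom.commutes, eq_ratCast]
  rw [← h2, h]
  simp only [IntermediateField.coe_val]
  congr!

/-- A relation between the conjugates of `ρ` and permutation representations, with natural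
coefficients, gives a multiplicative relation between BSD quotients. -/
theorem norm_pow_mul_prod_BSDQuotient (hiso : IsoInvariant B) (hC1 : C1 E B) (hC2 : C2 B)
    (e : (F ≃ₐ[ℚ] F) ≃* G) [Fintype (charField ρ ≃ₐ[ℚ] charField ρ)]
    (T : (charField ρ ≃ₐ[ℚ] charField ρ) → ArtinRep) (x : charField ρ)
    (hT : ∀ s, (∀ σ, (T s).ρ.character σ = s (charValue ρ (galProj e σ))) ∧ (B (T s) : ℂ) = s x)
    (n : ℕ) (H : ι → Subgroup G) (H' : κ → Subgroup G)
    (hrel : ∀ g : G, (n : ℂ) * ∑ s : charField ρ ≃ₐ[ℚ] charField ρ, (s (charValue ρ g) : ℂ) +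
      ∑ j, (indOne (H' j)).character g = ∑ i, (indOne (H i)).character g) :
    ((Algebra.norm ℚ x : ℚ) : ℝ) ^ n * ∏ j, BSDQuotient E (fixedSubfield e (H' j)) =
      ∏ i, BSDQuotient E (fixedSubfield e (H i)) := by
  -- `n` copies of every conjugate of `ρ`, together with the `Ind 1` for the `H' j`.
  let f : (Fin n × (charField ρ ≃ₐ[ℚ] charField ρ)) ⊕ κ → ArtinRep :=
    Sum.elim (fun p => T p.2) fun j => ArtinRep.ind (fixedSubfield e (H' j))
  have hf : ∀ σ a, (f a).ρ.character σ = Sum.elim (fun p => (p.2 (charValue ρ (galProj e σ)) : ℂ))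
      (fun j => (indOne (H' j)).character (galProj e σ)) a := by
    rintro σ (p | j)
    · exact (hT p.2).1 σ
    · exact character_ind_fixedSubfield e (H' j) σ
  have h := prod_eq_prod_of_sum_character_eq hiso hC2 f
    (fun i => ArtinRep.ind (fixedSubfield e (H i))) fun σ => by
      simp only [hf, character_ind_fixedSubfield, Fintype.sum_sum_type, Sum.elim_inl, Sum.elim_inr,
        Fintype.sum_prod_type, Finset.sum_const, Finset.card_univ, Fintype.card_fin, nsmul_eq_mul]
      exact hrel (galProj e σ)
  have h' := congrArg Units.val h
  have hnorm : ∏ s, (B (T s) : ℂ) = ((Algebra.norm ℚ x : ℚ) : ℂ) :=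
    (Fintype.prod_congr _ _ fun s => (hT s).2).trans (norm_eq_prod_conjugates x).symm
  simp only [f, Fintype.prod_sum_type, Sum.elim_inl, Sum.elim_inr, Fintype.prod_prod_type,
    Units.val_mul, Units.coe_prod, ← (hC1 _).1, Finset.prod_const, Finset.card_univ,
    Fintype.card_fin, Units.val_pow_eq_pow_val, hnorm] at h'
  exact_mod_cast h'

/-- For negative `m` the families `H` and `H'` exchange roles; dividing is harmless since BSD
quotients do not vanish. -/
theorem prod_BSDQuotient_div_eq_norm_zpow (hiso : IsoInvariant B) (hC1 : C1 E B) (hC2 : C2 B)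
    (e : (F ≃ₐ[ℚ] F) ≃* G) (T : (charField ρ ≃ₐ[ℚ] charField ρ) → ArtinRep) (x : charField ρ)
    (hT : ∀ s, (∀ σ, (T s).ρ.character σ = s (charValue ρ (galProj e σ))) ∧ (B (T s) : ℂ) = s x)
    (m : ℤ) (H : ι → Subgroup G) (H' : κ → Subgroup G)
    (hrel : ∀ g : G, (m : ℂ) * ∑ᶠ s : charField ρ ≃ₐ[ℚ] charField ρ, (s (charValue ρ g) : ℂ) =
      ∑ i, (indOne (H i)).character g - ∑ j, (indOne (H' j)).character g) :
    (∏ i, BSDQuotient E (fixedSubfield e (H i))) / (∏ j, BSDQuotient E (fixedSubfield e (H' j))) =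
      ((Algebra.norm ℚ x : ℚ) : ℝ) ^ m := by
  obtain ⟨_, _⟩ := isAbelianGalois_charField ρ
  have hH : ∏ i, BSDQuotient E (fixedSubfield e (H i)) ≠ 0 :=
    Finset.prod_ne_zero_iff.mpr fun i _ => BSDQuotient_ne_zero hC1 _
  have hH' : ∏ j, BSDQuotient E (fixedSubfield e (H' j)) ≠ 0 :=
    Finset.prod_ne_zero_iff.mpr fun i _ => BSDQuotient_ne_zero hC1 _
  simp only [finsum_eq_sum_of_fintype] at hrel
  obtain ⟨n, rfl | rfl⟩ := m.eq_nat_or_neg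
  · have h := norm_pow_mul_prod_BSDQuotient hiso hC1 hC2 e T x hT n H H' fun g => by
      have := hrel g
      push_cast at this
      linear_combination this
    rw [← h, zpow_natCast, mul_div_cancel_right₀ _ hH']
  · have h := norm_pow_mul_prod_BSDQuotient hiso hC1 hC2 e T x hT n H' H fun g => by
      have := hrel g
      push_cast at this
      linear_combination -this
    rw [zpow_neg, zpow_natCast, ← h, div_mul_cancel_right₀ hH]

/-- If `d = n c`, then `ζ_n = ζ_d ^ c`. The case `d = 0` is excluded because division by zero would
make `ζ_0 = 1`. -/
theorem cyclotomicInt_le_of_dvd {n d : ℕ} (hd : d ≠ 0) (h : n ∣ d) :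
    cyclotomicInt n ≤ cyclotomicInt d := by
  refine Algebra.adjoin_le ?_
  rw [Set.singleton_subset_iff]
  obtain ⟨c, rfl⟩ := h
  obtain ⟨hn, hc⟩ := mul_ne_zero_iff.mp hd
  have hn' : (n : ℂ) ≠ 0 := by exact_mod_cast hn
  have hc' : (c : ℂ) ≠ 0 := by exact_mod_cast hc
  have : Complex.exp (2 * Real.pi * Complex.I / n) =
      Complex.exp (2 * Real.pi * Complex.I / (n * c : ℕ)) ^ c := by
    rw [← Complex.exp_nat_mul]
    congr 1
    push_cast
    field_simp
  rw [SetLike.mem_coe, this]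
  exact pow_mem (Algebra.subset_adjoin (Set.mem_singleton _)) c

omit [Finite G] [FiniteDimensional ℂ V] in
/-- The order of a one-dimensional character divides the exponent of the group. -/
theorem orderOf_character_dvd_exponent (ρ : Representation ℂ G V) (h1 : Module.finrank ℂ V = 1) :
    orderOf ρ.character ∣ Monoid.exponent G := by
  have hfin : FiniteDimensional ℂ V := Module.finite_of_finrank_eq_succ h1
  -- On a line every endomorphism is its trace times the identity, so the character is
  -- multiplicative.
  have hsmul : ∀ f : V →ₗ[ℂ] V, f = LinearMap.trace ℂ V f • LinearMap.id := fun f => by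
    obtain ⟨v, hv, hspan⟩ := finrank_eq_one_iff'.mp h1
    obtain ⟨c, hc⟩ := hspan (f v)
    have hf : f = c • LinearMap.id := LinearMap.ext fun w => by
      obtain ⟨a, rfl⟩ := hspan w
      rw [map_smul, ← hc]
      exact smul_comm _ _ _
    have ht : LinearMap.trace ℂ V f = c := by
      rw [hf, map_smul, LinearMap.trace_id, h1, Nat.cast_one, smul_eq_mul, mul_one]
    rw [ht]; exact hf
  have hmul : ∀ a b, ρ.character (a * b) = ρ.character a * ρ.character b := fun a b => by
    rw [Representation.character, map_mul, hsmul (ρ a), smul_mul_assoc, map_smul, smul_eq_mul]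
    rfl
  let χ : G →* ℂ :=
    { toFun := ρ.character
      map_one' := by rw [Representation.char_one, h1, Nat.cast_one]
      map_mul' := hmul }
  refine orderOf_dvd_of_pow_eq_one (funext fun g => ?_)
  have := map_pow χ g (Monoid.exponent G)
  rw [Monoid.pow_exponent_eq_one, map_one] at this
  exact this.symm

end Main

end BSDTwist

theorem mainTheorem4 {G : Type*} [Group G] [Finite G]
    {V : Type} [AddCommGroup V] [Module ℂ V] [FiniteDimensional ℂ V]
    (ρ : Representation ℂ G V) (hρ : ρ.IsIrreducible)
    {ι κ : Type*} [Fintype ι] [Fintype κ]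
    (m : ℤ) (H : ι → Subgroup G) (H' : κ → Subgroup G)
    (hrel : ∀ g : G,
      (m : ℂ) * ∑ᶠ s : BSDTwist.charField ρ ≃ₐ[ℚ] BSDTwist.charField ρ,
          (s (BSDTwist.charValue ρ g) : ℂ) =
        ∑ i, (BSDTwist.indOne (H i)).character g - ∑ j, (BSDTwist.indOne (H' j)).character g)
    (E : WeierstrassCurve ℚ) [E.IsElliptic]
    (F : IntermediateField ℚ BSDTwist.Qbar) [FiniteDimensional ℚ F] [IsGalois ℚ F]
    (e : (F ≃ₐ[ℚ] F) ≃* G) :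
    (BSDTwist.Conjecture125 E →
      0 < BSDTwist.multiplicity E F (ρ.comp e.toMonoidHom) ∨
      ∃ x : BSDTwist.charField ρ,
        (∏ i, BSDTwist.BSDQuotient E (BSDTwist.fixedSubfield e (H i))) /
          (∏ j, BSDTwist.BSDQuotient E (BSDTwist.fixedSubfield e (H' j))) = ((Algebra.norm ℚ x : ℚ) : ℝ) ^ m) ∧
    (BSDTwist.Conjecture1256 E → ¬ ρ.IsTrivial → (∀ a b : G, a * b = b * a) →
      BSDTwist.IntegralityCondition E F (ρ.comp e.toMonoidHom) →
      0 < BSDTwist.multiplicity E F (ρ.comp e.toMonoidHom) ∨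
      ∃ x : BSDTwist.charField ρ, (x : ℂ) ∈ BSDTwist.cyclotomicInt (Monoid.exponent G) ∧
        (∏ i, BSDTwist.BSDQuotient E (BSDTwist.fixedSubfield e (H i))) /
          (∏ j, BSDTwist.BSDQuotient E (BSDTwist.fixedSubfield e (H' j))) = ((Algebra.norm ℚ x : ℚ) : ℝ) ^ m) := by
  constructor
  · rintro ⟨B, hiso, hC1, hC2, hC5⟩
    refine (BSDTwist.multiplicity_pos_or_eq_zero hC1 F _).imp_right fun h0 => ?_
    obtain ⟨x, -, T, hT⟩ := BSDTwist.exists_conjugates hC5 e h0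
    exact ⟨x, BSDTwist.prod_BSDQuotient_div_eq_norm_zpow hiso hC1 hC2 e T x hT m H H' hrel⟩
  · rintro ⟨B, hiso, hC1, hC2, hC5, hC6⟩ htriv hcomm hint
    refine (BSDTwist.multiplicity_pos_or_eq_zero hC1 F _).imp_right fun h0 => ?_
    obtain ⟨x, hx, T, hT⟩ := BSDTwist.exists_conjugates hC5 e h0
    refine ⟨x, ?_, BSDTwist.prod_BSDQuotient_div_eq_norm_zpow hiso hC1 hC2 e T x hT m H H' hrel⟩
    have : IsMulCommutative G := ⟨⟨hcomm⟩⟩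
    have h1 : Module.finrank ℂ V = 1 :=
      Representation.IsIrreducible.finrank_eq_one_of_isMulCommutative ρ
    -- C6 concerns `Gal(F/ℚ)`, so non-triviality is carried across `e`.
    have htriv' : ¬ Representation.IsTrivial (ρ.comp e.toMonoidHom) := fun h =>
      htriv ⟨fun g => by
        obtain ⟨a, rfl⟩ := e.surjective g
        exact h.out a⟩
    -- The `x` of the norm formula is `B(ρ)` itself, to which C6 applies directly.
    rw [hx]
    refine BSDTwist.cyclotomicInt_le_of_dvd Monoid.exponent_ne_zero_of_finite ?_
      (hC6 F V (ρ.comp e.toMonoidHom) h0 h1 htriv' hint)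
    rw [← Monoid.exponent_eq_of_mulEquiv e]
    exact BSDTwist.orderOf_character_dvd_exponent _ h1
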